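/- Let $p$ be a prime, let $H$ be a finite $p'$-group acting faithfully (by automorphisms) on a finite $p$-group $P$ of order $p^n$, and let $G=H\ltimes P$ be the semidirect product. Write $\Phi(G)$ for the Frattini subgroup of $G$, put $\overline G=G/\Phi(G)$, let $\overline P=P\Phi(G)/\Phi(G)$ be the image of $P$ in $\overline G$, and write $|\overline P|=p^{n-s}$. Let $d$ be an integer with $0<d<n$, and suppose that $G$ is a nontrivial $\mathcal{C}_{p^d}$-group, that is, $p^d$ is at most the $p$-part of $|G|$ and every subgroup $X\le G$ of order $p^d$ has a complement in $G$ (a subgroup $K\le G$ with $G=XK$ and $X\cap K=1$). Then one of the following holds. (1) $\overline G$ is supersolvable. (2) $H$ is cyclic, and $\overline P$, with the conjugation action of $H$, is a homogeneous $\mathbb{F}_p[H]$-module (a direct sum of pairwise isomorphic irreducible $\mathbb{F}_p[H]$-modules) all of whose irreducible submodules have the same $\mathbb{F}_p$-dimension $e>1$, where $e\mid\gcd(d-s,n-s)$. -/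

import Mathlib

/-- `G` is a `𝒞_{p^d}`-group: every subgroup `X` of `G` of order `p ^ d` has a complement `K`
in `G`, that is, `X * K = G` and `X ∩ K = 1`. -/
def IsCGroup (p d : ℕ) (G : Type*) [Group G] : Prop :=
  ∀ X : Subgroup G, Nat.card X = p ^ d → ∃ K : Subgroup G, X.IsComplement' K

/-- `G` is a nontrivial `𝒞_{p^d}`-group: moreover `p ^ d` is at most the `p`-part of `|G|`. -/
def IsNontrivialCGroup (p d : ℕ) (G : Type*) [Group G] : Prop :=
  IsCGroup p d G ∧ p ^ d ≤ ordProj[p] (Nat.card G)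

/-- `G` is supersolvable: there is a finite series `1 = N 0 ≤ N 1 ≤ ⋯ ≤ N k = G` of normal
subgroups of `G` such that every factor `N (i + 1) / N i` is cyclic. -/
def IsSupersolvableGroup (G : Type*) [Group G] : Prop :=
  ∃ (k : ℕ) (N : ℕ → Subgroup G), N 0 = ⊥ ∧ N k = ⊤ ∧
    ∀ i, i < k → N i ≤ N (i + 1) ∧ (N (i + 1)).Normal ∧
      ∃ _ : (N i).Normal, IsCyclic ((N (i + 1)).map (QuotientGroup.mk' (N i)))

/-- Let `f : H →* G` and let `A` be a subgroup of `G`. The proposition says that `A`, with `H`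
acting on it by conjugation through `f`, is (in additive notation) an `𝔽_p[H]`-module `V` which is
homogeneous, i.e. semisimple with all irreducible submodules isomorphic to one another, and all
irreducible submodules of which have dimension `e` over `𝔽_p`. The module structure is determined
by `f` and `A`, so that quantifying over `V` is only a way of introducing additive notation. -/
def IsHomogeneousFpModule.{u, v} (p e : ℕ) {H : Type v} {G : Type u} [Group H] [Group G]
    (f : H →* G) (A : Subgroup G) : Prop :=
  ∃ (V : Type u) (_ : AddCommGroup V) (_ : Module (ZMod p) V)
    (_ : Module (MonoidAlgebra (ZMod p) H) V)
    (_ : IsScalarTower (ZMod p) (MonoidAlgebra (ZMod p) H) V)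
    (ι : Multiplicative V ≃* A),
    (∀ (h : H) (v : V),
      (ι (Multiplicative.ofAdd (MonoidAlgebra.of (ZMod p) H h • v)) : G) =
        f h * (ι (Multiplicative.ofAdd v) : G) * (f h)⁻¹) ∧
    IsSemisimpleModule (MonoidAlgebra (ZMod p) H) V ∧
    IsIsotypic (MonoidAlgebra (ZMod p) H) V ∧
    ∀ W : Submodule (MonoidAlgebra (ZMod p) H) V,
      IsSimpleModule (MonoidAlgebra (ZMod p) H) W → Module.finrank (ZMod p) W = e

/-! Let $V=P/\Phi(P)$. By Maschke it is a semisimple $\mathbb{F}_p[H]$-module, and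
$P\cap\Phi(G)=\Phi(P)$, so $V\cong\overline P$ and $|\Phi(P)|=p^s$. A subspace of $V$ of dimension
$d-s$ has a preimage of order $p^d$; a complement $K$ of it in $G$ yields the submodule $(K\cap
P)\Phi(P)/\Phi(P)$, which complements the subspace. The group hypothesis thus becomes
`HasSubmoduleComplements` in dimension $d-s$, with $0<d-s<\dim V$.

If all simple submodules are lines, $H$ acts diagonally, hence is abelian, and $\overline G$ is
supersolvable. Otherwise let $S$ be simple of dimension $e>1$. A subspace in general position with
respect to the $S$-isotypic component $V_1$ and a complement of it has no submodule complement
unless $V_1=V$ (`eq_top_of_one_lt`). So $V\cong S^a$, every submodule has dimension divisible by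
$e$, and $e$ divides $d-s$ and $n-s$.

For cyclicity, let $E=\mathrm{End}(S)$, a finite field. Were $S$ not a line over $E$, then $2\dim
E\le e$, and this leaves room for a subspace that meets every submodule of the complementary
dimension (`exists_end_apply_eq_of_pi`). Hence $S=Es$, and $H$, faithful on $V$ and so on $S$,
embeds in $E^\times$. -/

open scoped commutatorElement

/-! ### Submodule complements force isotypicity -/

section ComplementedSubspaces

variable {k R V : Type*} [Field k] [Ring R] [Algebra k R] [AddCommGroup V] [Module k V] [Module R V]
  [IsScalarTower k R V]

/-- Every `k`-subspace of `V` of dimension `c` has a complement which is an `R`-submodule. -/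
def HasSubmoduleComplements (k R V : Type*) [Field k] [Ring R] [Algebra k R] [AddCommGroup V]
    [Module k V] [Module R V] [IsScalarTower k R V] (c : ℕ) : Prop :=
  ∀ X : Submodule k V, Module.finrank k X = c →
    ∃ U : Submodule R V, IsCompl X (U.restrictScalars k)

theorem Submodule.exists_le_finrank_eq [FiniteDimensional k V] (A : Submodule k V) (m : ℕ)
    (hm : m ≤ Module.finrank k A) : ∃ X ≤ A, Module.finrank k X = m := by
  obtain ⟨f, hf⟩ := exists_linearIndependent_of_le_finrank (R := k) (M := A) hm
  refine ⟨(Submodule.span k (Set.range f)).map A.subtype, Submodule.map_subtype_le _ _, ?_⟩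
  rw [(Submodule.equivMapOfInjective _ A.subtype_injective _).symm.finrank_eq,
    finrank_span_eq_card hf, Fintype.card_fin]

theorem Submodule.exists_ge_finrank_eq [FiniteDimensional k V] (A : Submodule k V) (m : ℕ)
    (hA : Module.finrank k A ≤ m) (hm : m ≤ Module.finrank k V) :
    ∃ X, A ≤ X ∧ Module.finrank k X = m := by
  obtain ⟨B, hB⟩ := A.exists_isCompl
  have hAB := Submodule.finrank_add_eq_of_isCompl hB
  obtain ⟨X, hXB, hX⟩ := Submodule.exists_le_finrank_eq B (m - Module.finrank k A) (by omega)
  refine ⟨A ⊔ X, le_sup_left, ?_⟩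
  have h := Submodule.finrank_sup_add_finrank_inf_eq A X
  rw [(hB.disjoint.mono_right hXB).eq_bot, finrank_bot] at h
  omega

theorem Submodule.finiteDimensional_of_isScalarTower [FiniteDimensional k V] (U : Submodule R V) :
    FiniteDimensional k U :=
  inferInstanceAs (FiniteDimensional k (U.restrictScalars k))

theorem IsIsotypicOfType.finrank_dvd [FiniteDimensional k V] [IsSemisimpleModule R V]
    {S : Type*} [AddCommGroup S] [Module k S] [Module R S] [IsScalarTower k R S]
    (h : IsIsotypicOfType R V S) : Module.finrank k S ∣ Module.finrank k V := by
  have : Module.Finite R V := Module.Finite.of_restrictScalars_finite k R V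
  obtain ⟨a, ⟨f⟩⟩ := h.linearEquiv_fun
  by_cases ha : a = 0
  · subst ha
    rw [(f.restrictScalars k).finrank_eq,
      Module.finrank_zero_of_subsingleton (M := Fin 0 → S)]
    exact dvd_zero _
  have : Nonempty (Fin a) := ⟨⟨0, Nat.pos_of_ne_zero ha⟩⟩
  have : FiniteDimensional k (Fin a → S) := .equiv (f.restrictScalars k)
  have : FiniteDimensional k S := Module.Finite.of_surjective
    (LinearMap.proj (R := k) (φ := fun _ : Fin a => S) ⟨0, Nat.pos_of_ne_zero ha⟩)
    (Function.surjective_eval _)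
  rw [(f.restrictScalars k).finrank_eq, Module.finrank_pi_fintype]
  simp

theorem exists_add_eq_not_dvd {D₁ D₂ c e : ℕ} (h₁ : 0 < D₁) (h₂ : 0 < D₂) (hc : 0 < c)
    (hcD : c < D₁ + D₂) (he : 1 < e) : ∃ x₁ x₂, x₁ ≤ D₁ ∧ x₂ ≤ D₂ ∧ x₁ + x₂ = c ∧ ¬ e ∣ x₁ := by
  -- The least admissible `x₁` is the truncated difference `c - D₂`; of it and its successor, at
  -- most one is divisible by `e`.
  by_cases h : e ∣ c - D₂
  · refine ⟨c - D₂ + 1, c - (c - D₂ + 1), by omega, by omega, by omega, fun h' => ?_⟩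
    have := (Nat.dvd_add_right h).mp h'
    rw [Nat.dvd_one] at this
    omega
  · exact ⟨c - D₂, c - (c - D₂), by omega, by omega, by omega, h⟩

/-- A submodule of `V₁ ⊕ V₂`, where `V₁` is an isotypic component, is the sum of its intersections
with `V₁` and `V₂`. -/
theorem Submodule.le_inf_isotypicComponent_sup [IsSemisimpleModule R V] (S : Submodule R V)
    [IsSimpleModule R S] {V₂ : Submodule R V} (hV : IsCompl (isotypicComponent R V S) V₂)
    (U : Submodule R V) : U ≤ (U ⊓ isotypicComponent R V S) ⊔ (U ⊓ V₂) := by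
  have hU : U = sSup {T : Submodule R V | IsSimpleModule R T ∧ T ≤ U} := by
    have := (sSup_atoms_le_eq U).symm
    simpa only [isSimpleModule_iff_isAtom] using this
  conv_lhs => rw [hU]
  refine sSup_le ?_
  rintro T ⟨hT, hTU⟩
  by_cases h : T ≤ isotypicComponent R V S
  · exact le_sup_of_le_left (le_inf hTU h)
  refine le_sup_of_le_right (le_inf hTU ?_)
  let π := (Submodule.projectionOnto _ _ hV).comp T.subtype
  obtain hinj | h0 := π.injective_or_eq_zero
  · refine absurd ?_ h
    have hiso := IsIsotypicOfType.isotypicComponent R V S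
    have e := LinearEquiv.ofInjective π hinj
    have : IsSimpleModule R (LinearMap.range π) := .congr e.symm
    obtain ⟨e'⟩ := hiso (LinearMap.range π)
    exact le_sSup ⟨e.trans e'⟩
  · intro t ht
    have := LinearMap.congr_fun h0 ⟨t, ht⟩
    rw [← Submodule.ker_projectionOnto hV]
    exact this

theorem HasSubmoduleComplements.eq_top_of_one_lt [FiniteDimensional k V] [IsSemisimpleModule R V]
    {c : ℕ} (h : HasSubmoduleComplements k R V c) (hc : 0 < c) (hcV : c < Module.finrank k V)
    (S : Submodule R V) [IsSimpleModule R S] (hS : 1 < Module.finrank k S) :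
    isotypicComponent R V S = ⊤ := by
  obtain ⟨V₂, hV⟩ := exists_isCompl (isotypicComponent R V S)
  by_contra hne
  have hV₂ : V₂ ≠ ⊥ := fun h0 => hne (by simpa [h0] using hV.sup_eq_top)
  set V₁ := isotypicComponent R V S with hV₁
  have hV₁0 : V₁ ≠ ⊥ := (bot_lt_isotypicComponent S).ne'
  have hV' : IsCompl (V₁.restrictScalars k) (V₂.restrictScalars k) := by
    constructor
    · rw [Submodule.disjoint_def]
      exact fun x hx hx' => Submodule.disjoint_def.mp hV.disjoint x hx hx'
    · rw [codisjoint_iff, Submodule.eq_top_iff']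
      intro x
      obtain ⟨y, hy, z, hz, rfl⟩ := Submodule.mem_sup.mp (hV.sup_eq_top ▸ Submodule.mem_top (x := x))
      exact Submodule.add_mem_sup hy hz
  have hdim := Submodule.finrank_add_eq_of_isCompl hV'
  have hp : ∀ W : Submodule R V, W ≠ ⊥ → 0 < Module.finrank k (W.restrictScalars k) := by
    intro W hW
    refine Nat.pos_of_ne_zero fun h0 => hW ?_
    rw [Submodule.finrank_eq_zero] at h0
    exact (Submodule.restrictScalars_eq_bot_iff ..).mp h0
  obtain ⟨x₁, x₂, hx₁, hx₂, hx, hndvd⟩ :=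
    exists_add_eq_not_dvd (hp V₁ hV₁0) (hp V₂ hV₂) hc (by omega) hS
  obtain ⟨X₁, hX₁, hX₁'⟩ := Submodule.exists_le_finrank_eq (V₁.restrictScalars k) x₁ hx₁
  obtain ⟨X₂, hX₂, hX₂'⟩ := Submodule.exists_le_finrank_eq (V₂.restrictScalars k) x₂ hx₂
  obtain ⟨U, hU⟩ := h (X₁ ⊔ X₂) (by
    have := Submodule.finrank_sup_add_finrank_inf_eq X₁ X₂
    rw [(hV'.disjoint.mono hX₁ hX₂).eq_bot, finrank_bot] at this
    omega)
  apply hndvd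
  -- Both `X₁ ⊔ X₂` and `U` split along `V₁ ⊕ V₂`, so `U ⊓ V₁` complements `X₁` inside `V₁`. As `V₁`
  -- and `U ⊓ V₁` are isotypic of type `S`, `finrank k S` then divides `x₁`.
  have hle : V₁.restrictScalars k ≤ X₁ ⊔ (U ⊓ V₁).restrictScalars k := by
    intro v hv
    obtain ⟨x, hxm, u, hu, rfl⟩ := Submodule.mem_sup.mp (hU.sup_eq_top ▸ Submodule.mem_top (x := v))
    obtain ⟨y₁, hy₁, y₂, hy₂, rfl⟩ := Submodule.mem_sup.mp hxm
    obtain ⟨u₁, hu₁, u₂, hu₂, rfl⟩ := Submodule.mem_sup.mp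
      (Submodule.le_inf_isotypicComponent_sup S hV U hu)
    have h1 : y₁ + u₁ ∈ V₁ := V₁.add_mem (hX₁ hy₁) hu₁.2
    have h2 : y₂ + u₂ ∈ V₂ := V₂.add_mem (hX₂ hy₂) hu₂.2
    have h3 : y₂ + u₂ ∈ V₁ := by
      have : y₂ + u₂ = (y₁ + y₂ + (u₁ + u₂)) - (y₁ + u₁) := by abel
      rw [this]
      exact V₁.sub_mem hv h1
    have h4 := Submodule.disjoint_def.mp hV.disjoint _ h3 h2
    have : y₁ + y₂ + (u₁ + u₂) = y₁ + u₁ + (y₂ + u₂) := by abel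
    rw [this, h4, add_zero]
    exact Submodule.add_mem_sup hy₁ hu₁
  have heq : X₁ ⊔ (U ⊓ V₁).restrictScalars k = V₁.restrictScalars k :=
    le_antisymm (sup_le hX₁ fun _ hx => hx.2) hle
  have hdis : X₁ ⊓ (U ⊓ V₁).restrictScalars k = ⊥ :=
    (hU.disjoint.mono le_sup_left fun _ hx => hx.1).eq_bot
  have hfr := Submodule.finrank_sup_add_finrank_inf_eq X₁ ((U ⊓ V₁).restrictScalars k)
  rw [heq, hdis, finrank_bot, add_zero, hX₁'] at hfr
  have := V₁.finiteDimensional_of_isScalarTower (k := k)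
  have := (U ⊓ V₁).finiteDimensional_of_isScalarTower (k := k)
  have d1 : Module.finrank k S ∣ Module.finrank k (V₁.restrictScalars k) :=
    (IsIsotypicOfType.isotypicComponent R V S).finrank_dvd (k := k)
  have d2 : Module.finrank k S ∣ Module.finrank k ((U ⊓ V₁).restrictScalars k) :=
    ((IsIsotypicOfType.isotypicComponent R V S).of_injective
      (Submodule.inclusion (inf_le_right : U ⊓ V₁ ≤ V₁))
      (Submodule.inclusion_injective _)).finrank_dvd (k := k) (V := (U ⊓ V₁ : Submodule R V))
  exact (Nat.dvd_add_left d2).mp (hfr ▸ d1)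

theorem HasSubmoduleComplements.finrank_dvd [FiniteDimensional k V] [IsSemisimpleModule R V]
    {c : ℕ} (h : HasSubmoduleComplements k R V c) (hcV : c ≤ Module.finrank k V)
    (S : Submodule R V) (hS : IsIsotypicOfType R V S) : Module.finrank k S ∣ c := by
  obtain ⟨X, -, hX⟩ := Submodule.exists_le_finrank_eq (⊤ : Submodule k V) c (by simpa)
  obtain ⟨U, hU⟩ := h X hX
  have hdim := Submodule.finrank_add_eq_of_isCompl hU
  have := U.finiteDimensional_of_isScalarTower (k := k)
  have d1 := hS.finrank_dvd (k := k)
  have d2 : Module.finrank k S ∣ Module.finrank k (U.restrictScalars k) :=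
    (hS.of_injective U.subtype U.subtype_injective).finrank_dvd (k := k)
  exact (Nat.dvd_add_left d2).mp (by rwa [← hX, hdim])

end ComplementedSubspaces

/-! ### Simple modules that are lines over their endomorphism ring -/

section SimpleModules

variable {k R V S : Type*} [Field k] [Ring R] [Algebra k R] [AddCommGroup V] [Module k V]
  [Module R V] [IsScalarTower k R V] [AddCommGroup S] [Module k S] [Module R S]
  [IsScalarTower k R S]

theorem HasSubmoduleComplements.of_linearEquiv {W : Type*} [AddCommGroup W] [Module k W]
    [Module R W] [IsScalarTower k R W] {c : ℕ} (h : HasSubmoduleComplements k R V c)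
    (f : V ≃ₗ[R] W) : HasSubmoduleComplements k R W c := by
  intro X hX
  let g := f.restrictScalars k
  obtain ⟨U, hU⟩ := h (X.map (g.symm : W →ₗ[k] V)) (by rw [LinearEquiv.finrank_map_eq, hX])
  refine ⟨U.map (f : V →ₗ[R] W), ?_⟩
  have h' := (Submodule.orderIsoMapComap g).isCompl hU
  have hX' : Submodule.orderIsoMapComap g (X.map (g.symm : W →ₗ[k] V)) = X := by
    rw [← Submodule.comap_equiv_eq_map_symm]
    exact (Submodule.orderIsoMapComap g).apply_symm_apply X
  rw [hX'] at h'
  exact h'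

theorem Module.End.apply_injective [IsSimpleModule R S] {s : S} (hs : s ≠ 0) :
    Function.Injective fun α : Module.End R S => α s := by
  intro α β h
  by_contra hne
  have hsub : α - β ≠ 0 := sub_ne_zero.mpr hne
  have hinj := ((α - β).injective_or_eq_zero).resolve_right hsub
  refine hs (hinj ?_)
  simpa [sub_eq_zero] using h

theorem Module.End.finiteDimensional_of_isSimpleModule [FiniteDimensional k S]
    [IsSimpleModule R S] : FiniteDimensional k (Module.End R S) := by
  have := IsSimpleModule.nontrivial R S
  obtain ⟨s, hs⟩ := exists_ne (0 : S)
  let f : Module.End R S →ₗ[k] S :=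
    { toFun := fun α => α s
      map_add' := fun _ _ => rfl
      map_smul' := fun _ _ => rfl }
  exact FiniteDimensional.of_injective f (Module.End.apply_injective hs)

/-- By Schur the endomorphism ring `E` is a division ring, so a vector `t` outside the line `E s`
gives independent lines `E s` and `E t`, each a copy of `E`. -/
theorem Module.End.two_mul_finrank_le [FiniteDimensional k S] [IsSimpleModule R S] {s t : S}
    (hs : s ≠ 0) (ht : ∀ α : Module.End R S, α s ≠ t) :
    Module.finrank k (Module.End R S) + Module.finrank k (Module.End R S) ≤
      Module.finrank k S := by
  have := Module.End.finiteDimensional_of_isSimpleModule (k := k) (R := R) (S := S)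
  let f : Module.End R S × Module.End R S →ₗ[k] S :=
    { toFun := fun α => α.1 s + α.2 t
      map_add' := fun α β => by simp; abel
      map_smul' := fun c α => by simp }
  rw [← Module.finrank_prod]
  refine LinearMap.finrank_le_finrank_of_injective (f := f) ?_
  rw [← LinearMap.ker_eq_bot, LinearMap.ker_eq_bot']
  rintro ⟨α, β⟩ h
  have h : α s + β t = 0 := h
  obtain hβ | rfl := β.bijective_or_eq_zero
  · exfalso
    let b := LinearEquiv.ofBijective β hβ
    refine ht (-((b.symm : S →ₗ[R] S) ∘ₗ α)) ?_
    apply hβ.1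
    have : β (b.symm (α s)) = α s := b.apply_symm_apply _
    rw [LinearMap.neg_apply, map_neg]
    exact (congrArg Neg.neg this).trans (neg_eq_of_add_eq_zero_right h)
  · have : α = 0 := Module.End.apply_injective hs (by simpa using h)
    simp [this]

/-- If `E s ≠ S`, where `E` is the endomorphism ring, the subspace $S^b\times Es\times Es\times 0$
has dimension at most $(b+1)e$. By dimension, a complementary submodule meets $S^{b+2}\times 0$, and
any simple submodule found there meets the subspace. -/
theorem HasSubmoduleComplements.exists_end_apply_eq_of_pi [FiniteDimensional k S]
    [IsSimpleModule R S] {a b : ℕ} (hb : b + 1 < a)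
    (h : HasSubmoduleComplements k R (Fin a → S) ((b + 1) * Module.finrank k S))
    {s : S} (hs : s ≠ 0) (t : S) : ∃ α : Module.End R S, α s = t := by
  by_contra! ht
  have hE := Module.End.two_mul_finrank_le (k := k) hs ht
  have := Module.End.finiteDimensional_of_isSimpleModule (k := k) (R := R) (S := S)
  have hpos : 0 < Module.finrank k S := Module.finrank_pos_iff_exists_ne_zero.mpr ⟨s, hs⟩
  set e := Module.finrank k S with he
  have hpi : ∀ m, Module.finrank k (Fin m → S) = m * e := fun m => by
    rw [Module.finrank_pi_fintype]; simp [he]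
  let L : (Fin b → S) × (Module.End R S × Module.End R S) →ₗ[k] (Fin a → S) :=
    { toFun := fun f i => if hi : (i : ℕ) < b then f.1 ⟨i, hi⟩ else
        if (i : ℕ) = b then f.2.1 s else if (i : ℕ) = b + 1 then f.2.2 s else 0
      map_add' := fun f g => by
        ext i
        simp only [Pi.add_apply]
        split_ifs <;> simp
      map_smul' := fun c f => by
        ext i
        simp only [Pi.smul_apply, RingHom.id_apply]
        split_ifs <;> simp }
  have hL : Module.finrank k (LinearMap.range L) ≤ (b + 1) * e := by
    refine (LinearMap.finrank_range_le L).trans ?_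
    rw [Module.finrank_prod, Module.finrank_prod, hpi]
    linarith
  obtain ⟨X, hLX, hX⟩ := Submodule.exists_ge_finrank_eq _ _ hL
    (by rw [hpi]; exact Nat.mul_le_mul_right _ hb.le)
  obtain ⟨U, hU⟩ := h X hX
  have hdim := Submodule.finrank_add_eq_of_isCompl hU
  rw [hX, hpi] at hdim
  let T : Fin (a - (b + 2)) → Fin a := fun i => ⟨i + (b + 2), by omega⟩
  let π : (Fin a → S) →ₗ[R] (Fin (a - (b + 2)) → S) := LinearMap.funLeft R S T
  let W : Submodule R (Fin a → S) := U ⊓ LinearMap.ker π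
  -- `U` has dimension $(a-b-1)e$, one copy of `S` more than the target of `π`.
  have hW : W ≠ ⊥ := by
    intro hW
    have hlt : Module.finrank k (Fin (a - (b + 2)) → S) <
        Module.finrank k (U.restrictScalars k) := by
      rw [hpi]
      obtain ⟨r, rfl⟩ : ∃ r, a = b + 2 + r := ⟨a - (b + 2), by omega⟩
      simp only [Nat.add_sub_cancel_left]
      nlinarith
    obtain ⟨u, hu, hu0⟩ := Submodule.exists_mem_ne_zero_of_ne_bot
      (LinearMap.ker_ne_bot_of_finrank_lt
        (f := (π.restrictScalars k).comp (U.restrictScalars k).subtype) hlt)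
    have : (u : Fin a → S) ∈ W := ⟨u.2, hu⟩
    rw [hW, Submodule.mem_bot] at this
    exact hu0 (Subtype.ext this)
  obtain ⟨w, hw, hw0, α, β, hα, hβ⟩ : ∃ w ∈ W, w ≠ 0 ∧ ∃ α β : Module.End R S,
      w ⟨b, by omega⟩ = α s ∧ w ⟨b + 1, by omega⟩ = β s := by
    obtain ⟨T, hTW, hT⟩ := (IsSemisimpleModule.eq_bot_or_exists_simple_le W).resolve_left hW
    let p₀ : T →ₗ[R] S := (LinearMap.proj (R := R) (φ := fun _ => S) ⟨b, by omega⟩).comp T.subtype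
    let p₁ : T →ₗ[R] S :=
      (LinearMap.proj (R := R) (φ := fun _ => S) ⟨b + 1, by omega⟩).comp T.subtype
    -- If one of the coordinates `b`, `b + 1` is an isomorphism on `T`, take `w` to be the preimage
    -- of `s` under it; any other coordinate of `w` is then an endomorphism applied to `s`.
    have key : ∀ p : T →ₗ[R] S, Function.Bijective p → ∃ w : T, w ≠ 0 ∧
        ∀ q : T →ₗ[R] S, ∃ α : Module.End R S, q w = α s := by
      intro p hp
      let g := LinearEquiv.ofBijective p hp
      refine ⟨g.symm s, by simpa using hs, fun q => ⟨q ∘ₗ (g.symm : S →ₗ[R] T), rfl⟩⟩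
    obtain hp₀ | hp₀ := p₀.bijective_or_eq_zero
    · obtain ⟨w, hw, hq⟩ := key p₀ hp₀
      obtain ⟨α, hα⟩ := hq p₀
      obtain ⟨β, hβ⟩ := hq p₁
      exact ⟨w, hTW w.2, by simpa using hw, α, β, hα, hβ⟩
    · obtain hp₁ | hp₁ := p₁.bijective_or_eq_zero
      · obtain ⟨w, hw, hq⟩ := key p₁ hp₁
        obtain ⟨α, hα⟩ := hq p₀
        obtain ⟨β, hβ⟩ := hq p₁
        exact ⟨w, hTW w.2, by simpa using hw, α, β, hα, hβ⟩
      · have := IsSimpleModule.nontrivial R T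
        obtain ⟨w, hw⟩ := exists_ne (0 : T)
        exact ⟨w, hTW w.2, by simpa using hw, 0, 0, LinearMap.congr_fun hp₀ w,
          LinearMap.congr_fun hp₁ w⟩
  refine hw0 (Submodule.disjoint_def.mp hU.disjoint w (hLX ?_) hw.1)
  refine ⟨(fun i => w ⟨i, by omega⟩, α, β), ?_⟩
  ext i
  simp only [L, LinearMap.coe_mk, AddHom.coe_mk]
  split_ifs with h1 h2 h3
  · rfl
  · rw [← hα]; congr 1; ext; exact h2.symm
  · rw [← hβ]; congr 1; ext; exact h3.symm
  · have h4 := congr_fun (LinearMap.mem_ker.mp hw.2) ⟨i - (b + 2), by omega⟩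
    have h5 : T ⟨i - (b + 2), by omega⟩ = i := by ext; simp only [T]; omega
    have h6 : w (T ⟨i - (b + 2), by omega⟩) = 0 := h4
    rw [h5] at h6
    exact h6.symm

theorem HasSubmoduleComplements.exists_end_apply_eq [FiniteDimensional k V]
    [IsSemisimpleModule R V] {c : ℕ} (h : HasSubmoduleComplements k R V c) (hc : 0 < c)
    (hcV : c < Module.finrank k V) (S : Submodule R V) [IsSimpleModule R S]
    (hS : IsIsotypicOfType R V S) {s : S} (hs : s ≠ 0) (t : S) :
    ∃ α : Module.End R S, α s = t := by
  have : Module.Finite R V := Module.Finite.of_restrictScalars_finite k R V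
  have := S.finiteDimensional_of_isScalarTower (k := k)
  obtain ⟨a, ⟨f⟩⟩ := hS.linearEquiv_fun
  obtain ⟨b, rfl⟩ := h.finrank_dvd hcV.le S hS
  rw [(f.restrictScalars k).finrank_eq, Module.finrank_pi_fintype] at hcV
  simp only [Finset.sum_const, Finset.card_univ, Fintype.card_fin, smul_eq_mul] at hcV
  have hb : b ≠ 0 := by rintro rfl; simp at hc
  obtain ⟨b, rfl⟩ := Nat.exists_eq_succ_of_ne_zero hb
  rw [mul_comm] at hcV h
  exact (h.of_linearEquiv f).exists_end_apply_eq_of_pi (lt_of_mul_lt_mul_right' hcV) hs t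

end SimpleModules

/-! ### Cyclicity of the acting group -/

section Cyclic

variable {k H S : Type*} [Field k] [Group H] [Finite H] [AddCommGroup S]
  [Module (MonoidAlgebra k H) S]

/-- A finite group acting faithfully on a finite simple module generated over its endomorphism
ring by one vector is cyclic. -/
theorem isCyclic_of_exists_end_apply_eq [Finite S] [IsSimpleModule (MonoidAlgebra k H) S]
    (hfaith : ∀ h : H, (∀ x : S, MonoidAlgebra.of k H h • x = x) → h = 1) {s : S} (hs : s ≠ 0)
    (hE : ∀ t : S, ∃ α : Module.End (MonoidAlgebra k H) S, α s = t) : IsCyclic H := by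
  classical
  set E := Module.End (MonoidAlgebra k H) S with hEdef
  have : Finite E := Finite.of_injective _ (Module.End.apply_injective hs)
  let F : Field E := littleWedderburn E
  have hcomm : ∀ α β : E, α * β = β * α := F.mul_comm
  -- The endomorphism `χ h` agrees with `h` at `s`, hence on all of `E s = S` because `E` is
  -- commutative by Wedderburn.
  choose χ hχ using fun h : H => hE (MonoidAlgebra.of k H h • s)
  have hact : ∀ (h : H) (x : S), χ h x = MonoidAlgebra.of k H h • x := by
    intro h x
    obtain ⟨β, rfl⟩ := hE x
    rw [← map_smul, ← hχ h]
    exact LinearMap.congr_fun (hcomm (χ h) β) s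
  let f : H →* E :=
    { toFun := χ
      map_one' := LinearMap.ext fun x => by rw [hact, map_one, one_smul]; rfl
      map_mul' := fun g h => LinearMap.ext fun x => by
        rw [hact, Module.End.mul_apply, hact, hact, map_mul, mul_smul] }
  refine isCyclic_of_injective_ringHom f ((injective_iff_map_eq_one f).mpr fun h hh => ?_)
  refine hfaith h fun x => ?_
  rw [← hact]
  exact LinearMap.congr_fun hh x

end Cyclic

/-! ### The Frattini subgroup of a finite p-group -/

section FrattiniSubgroup

variable {p : ℕ} [Fact p.Prime] {P : Type*} [Group P] [Finite P]

theorem IsPGroup.card_quotient_of_isCoatom (hP : IsPGroup p P) {M : Subgroup P} [M.Normal]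
    (hM : IsCoatom M) : Nat.card (P ⧸ M) = p := by
  have hnt : Nontrivial (P ⧸ M) := QuotientGroup.nontrivial_iff.mpr hM.1
  have hdvd : p ^ 1 ∣ Nat.card (P ⧸ M) := by
    obtain ⟨m, hm, h⟩ := (hP.to_quotient M).nontrivial_iff_card.mp hnt
    rw [h]
    exact pow_dvd_pow p hm
  obtain ⟨K, hK⟩ := Sylow.exists_subgroup_card_pow_prime p hdvd
  rw [pow_one] at hK
  have hKtop : K = ⊤ := by
    have hle : M ≤ K.comap (QuotientGroup.mk' M) := fun x hx => by
      rw [Subgroup.mem_comap, QuotientGroup.mk'_apply, (QuotientGroup.eq_one_iff x).mpr hx]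
      exact K.one_mem
    obtain h | h := hle.eq_or_lt
    · exfalso
      have h1 : K = ⊥ := by
        rw [← Subgroup.map_comap_eq_self_of_surjective (QuotientGroup.mk'_surjective M) K, ← h,
          Subgroup.map_eq_bot_iff, QuotientGroup.ker_mk']
      rw [h1, Subgroup.card_bot] at hK
      exact (Fact.out : p.Prime).one_lt.ne hK
    · rw [← Subgroup.map_comap_eq_self_of_surjective (QuotientGroup.mk'_surjective M) K,
        hM.2 _ h, ← MonoidHom.range_eq_map, QuotientGroup.range_mk']
  rwa [hKtop, Subgroup.card_top] at hK

theorem IsPGroup.mem_frattini_of_forall (hP : IsPGroup p P) {x : P}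
    (h : ∀ M : Subgroup P, M.Normal → Nat.card (P ⧸ M) = p → x ∈ M) : x ∈ frattini P := by
  have : Group.IsNilpotent P := hP.isNilpotent
  simp only [frattini, Order.radical, Subgroup.mem_iInf]
  intro M hM
  have : M.Normal := Subgroup.NormalizerCondition.normal_of_coatom M
    Group.normalizerCondition_of_isNilpotent hM
  exact h M this (hP.card_quotient_of_isCoatom hM)

theorem IsPGroup.pow_mem_frattini (hP : IsPGroup p P) (x : P) : x ^ p ∈ frattini P :=
  hP.mem_frattini_of_forall fun M _ hM => by
    rw [← QuotientGroup.eq_one_iff, QuotientGroup.mk_pow, ← hM]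
    exact pow_card_eq_one'

theorem IsPGroup.commutator_mem_frattini (hP : IsPGroup p P) (x y : P) : ⁅x, y⁆ ∈ frattini P :=
  hP.mem_frattini_of_forall fun M _ hM => by
    have : IsCyclic (P ⧸ M) := isCyclic_of_prime_card hM
    rw [← QuotientGroup.ker_mk' M, MonoidHom.mem_ker, map_commutatorElement,
      commutatorElement_eq_one_iff_mul_comm]
    have := IsCyclic.isMulCommutative (α := P ⧸ M)
    exact mul_comm' _ _

end FrattiniSubgroup

/-! ### A criterion for supersolvability -/

section Supersolvable

variable {G : Type*} [Group G]

theorem isCyclic_map_mk'_sup_zpowers (A : Subgroup G) [A.Normal] (g : G) :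
    IsCyclic ((A ⊔ Subgroup.zpowers g).map (QuotientGroup.mk' A)) := by
  have : (A ⊔ Subgroup.zpowers g).map (QuotientGroup.mk' A) =
      Subgroup.zpowers (QuotientGroup.mk' A g) := by
    rw [Subgroup.map_sup, QuotientGroup.map_mk'_self, bot_sup_eq, MonoidHom.map_zpowers]
  rw [this]
  infer_instance

theorem isSupersolvableGroup_of_exists_normal [Finite G]
    (h : ∀ A : Subgroup G, A.Normal → A ≠ ⊤ → ∃ g ∉ A, (A ⊔ Subgroup.zpowers g).Normal) :
    IsSupersolvableGroup G := by
  -- The series is allowed to start at any normal `A`, so that induction can go upwards from `A` to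
  -- the whole group.
  suffices H : ∀ A : Subgroup G, A.Normal → ∃ (k : ℕ) (N : ℕ → Subgroup G), N 0 = A ∧ N k = ⊤ ∧
      ∀ i, i < k → N i ≤ N (i + 1) ∧ (N (i + 1)).Normal ∧
        ∃ _ : (N i).Normal, IsCyclic ((N (i + 1)).map (QuotientGroup.mk' (N i))) from
    H ⊥ inferInstance
  intro A
  induction A using WellFoundedGT.induction with
  | ind A ih =>
    intro hA
    by_cases htop : A = ⊤
    · exact ⟨0, fun _ => ⊤, htop.symm, rfl, by simp⟩
    obtain ⟨g, hg, hn⟩ := h A hA htop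
    have hlt : A < A ⊔ Subgroup.zpowers g := lt_of_le_of_ne le_sup_left fun heq => hg <| by
      rw [heq]
      exact Subgroup.mem_sup_right (Subgroup.mem_zpowers g)
    obtain ⟨k, N, hN0, hNk, hN⟩ := ih _ hlt hn
    refine ⟨k + 1, fun i => Nat.casesOn i A N, rfl, hNk, ?_⟩
    rintro (_ | i) hi
    · change A ≤ N 0 ∧ (N 0).Normal ∧ ∃ _ : A.Normal, IsCyclic ((N 0).map (QuotientGroup.mk' A))
      rw [hN0]
      exact ⟨hlt.le, hn, hA, isCyclic_map_mk'_sup_zpowers A g⟩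
    · exact hN i (Nat.lt_of_succ_lt_succ hi)

end Supersolvable

/-! ### The Frattini quotient as a module -/

section FrattiniQuotient

variable {p : ℕ} [Fact p.Prime] {H P V : Type*} [Group H] [Group P]
  [AddCommGroup V] [Module (ZMod p) V] [Module (MonoidAlgebra (ZMod p) H) V]
  [IsScalarTower (ZMod p) (MonoidAlgebra (ZMod p) H) V] {φ : H →* MulAut P}

/-- The homomorphism `q` identifies the `𝔽_p[H]`-module `V` with the Frattini quotient of the
group `P` on which `H` acts by `φ`. -/
structure IsFrattiniQuotient (p : ℕ) [Fact p.Prime] {H P V : Type*} [Group H] [Group P]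
    [AddCommGroup V] [Module (ZMod p) V] [Module (MonoidAlgebra (ZMod p) H) V]
    (φ : H →* MulAut P) (q : P →* Multiplicative V) : Prop where
  surjective : Function.Surjective q
  ker_eq : q.ker = frattini P
  map_smul : ∀ h x, (q (φ h x)).toAdd = MonoidAlgebra.of (ZMod p) H h • (q x).toAdd

theorem exists_isFrattiniQuotient_of_ker_eq (p : ℕ) [Fact p.Prime] {H P V : Type*} [Group H]
    [Group P] [Finite P] (φ : H →* MulAut P) [AddCommGroup V]
    [Module (ZMod p) V]
    (q : P →* Multiplicative V) (hq : Function.Surjective q) (hker : q.ker = frattini P) :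
    ∃ (_ : Module (MonoidAlgebra (ZMod p) H) V)
      (_ : IsScalarTower (ZMod p) (MonoidAlgebra (ZMod p) H) V), IsFrattiniQuotient p φ q := by
  have hle : ∀ h : H, q.ker ≤ (q.comp (φ h : P →* P)).ker := fun h x hx => by
    rw [hker] at hx
    rw [MonoidHom.mem_ker, MonoidHom.comp_apply, ← MonoidHom.mem_ker, hker]
    have := Subgroup.characteristic_iff_comap_eq.mp (inferInstance : (frattini P).Characteristic)
      (φ h)
    rw [← this] at hx
    exact hx
  let T : H → Multiplicative V →* Multiplicative V := fun h =>
    q.liftOfSurjective hq ⟨q.comp (φ h : P →* P), hle h⟩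
  have hT : ∀ h x, T h (q x) = q (φ h x) := fun h x =>
    q.liftOfRightInverse_comp_apply _ _ ⟨q.comp (φ h : P →* P), hle h⟩ x
  let σ : H → Module.End (ZMod p) V :=
    fun h => (AddMonoidHom.toMultiplicative.symm (T h)).toZModLinearMap p
  have hσ : ∀ h x, σ h (q x).toAdd = (q (φ h x)).toAdd := fun h x =>
    congrArg Multiplicative.toAdd (hT h x)
  have hσ_one : σ 1 = 1 := by
    refine LinearMap.ext fun v => ?_
    obtain ⟨x, rfl⟩ := hq v
    exact (hσ 1 x).trans (by rw [map_one]; rfl)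
  have hσ_mul : ∀ g h, σ (g * h) = σ g * σ h := fun g h => by
    refine LinearMap.ext fun v => ?_
    obtain ⟨x, rfl⟩ := hq v
    refine (hσ (g * h) x).trans ?_
    rw [map_mul]
    exact ((congrArg (σ g) (hσ h x)).trans (hσ g _)).symm
  let ρ : H →* Module.End (ZMod p) V := ⟨⟨σ, hσ_one⟩, hσ_mul⟩
  let : Module (MonoidAlgebra (ZMod p) H) V :=
    Module.compHom V (Representation.asAlgebraHom ρ).toRingHom
  have hsmul : ∀ (r : MonoidAlgebra (ZMod p) H) (v : V), r • v =
      (Representation.asAlgebraHom ρ r : V →ₗ[ZMod p] V) v :=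
    fun _ _ => rfl
  refine ⟨inferInstance, ⟨fun c r v => ?_⟩, hq, hker, ?_⟩
  · rw [hsmul, hsmul, map_smul, LinearMap.smul_apply]
  · intro h x
    rw [hsmul, Representation.asAlgebraHom_of]
    exact (hσ h x).symm

theorem exists_isFrattiniQuotient.{u, v} (p : ℕ) [Fact p.Prime] {H : Type u} {P : Type v} [Group H]
    [Group P] [Finite P] (hP : IsPGroup p P) (φ : H →* MulAut P) :
    ∃ (V : Type max u v) (_ : AddCommGroup V) (_ : Module (ZMod p) V)
      (_ : Module (MonoidAlgebra (ZMod p) H) V)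
      (_ : IsScalarTower (ZMod p) (MonoidAlgebra (ZMod p) H) V) (q : P →* Multiplicative V),
      IsFrattiniQuotient p φ q := by
  -- The lift places `V` in the universe of `P ⋊[φ] H`, as `IsHomogeneousFpModule` requires.
  let : CommGroup (ULift.{u} (P ⧸ frattini P)) :=
    { (inferInstance : Group (ULift.{u} (P ⧸ frattini P))) with
      mul_comm := by
        rintro ⟨x⟩ ⟨y⟩
        obtain ⟨x, rfl⟩ := QuotientGroup.mk_surjective x
        obtain ⟨y, rfl⟩ := QuotientGroup.mk_surjective y
        apply ULift.ext
        change QuotientGroup.mk' (frattini P) x * QuotientGroup.mk' (frattini P) y =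
          QuotientGroup.mk' (frattini P) y * QuotientGroup.mk' (frattini P) x
        rw [← commutatorElement_eq_one_iff_mul_comm, ← map_commutatorElement]
        exact (QuotientGroup.eq_one_iff (N := frattini P) _).mpr (hP.commutator_mem_frattini x y) }
  let V : Type max u v := Additive (ULift.{u} (P ⧸ frattini P))
  let q : P →* Multiplicative V :=
    (MulEquiv.multiplicativeAdditive (ULift.{u} (P ⧸ frattini P))).symm.toMonoidHom.comp
      (MulEquiv.ulift.symm.toMonoidHom.comp (QuotientGroup.mk' (frattini P)))
  have hq : Function.Surjective q :=
    (MulEquiv.multiplicativeAdditive (ULift.{u} (P ⧸ frattini P))).symm.surjective.comp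
      (MulEquiv.ulift.symm.surjective.comp (QuotientGroup.mk'_surjective (frattini P)))
  have hker : q.ker = frattini P := by
    ext x
    simp [q]
  let : Module (ZMod p) V := AddCommGroup.zmodModule fun v => by
    obtain ⟨x, hx⟩ := hq (Multiplicative.ofAdd v)
    apply Multiplicative.ofAdd.injective
    rw [ofAdd_nsmul, ← hx, ← map_pow, ofAdd_zero, ← MonoidHom.mem_ker, hker]
    exact hP.pow_mem_frattini x
  obtain ⟨i₂, i₃, h⟩ := exists_isFrattiniQuotient_of_ker_eq p φ q hq hker
  exact ⟨V, inferInstance, inferInstance, i₂, i₃, q, h⟩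

/-- An `H`-invariant additive subgroup of an `𝔽_p[H]`-module, as a submodule. -/
def AddSubgroup.toMonoidAlgebraSubmodule (W : AddSubgroup V)
    (hW : ∀ (h : H), ∀ w ∈ W, MonoidAlgebra.of (ZMod p) H h • w ∈ W) :
    Submodule (MonoidAlgebra (ZMod p) H) V :=
  { W with
    smul_mem' := fun r w hw => by
      change r • w ∈ W
      induction r using MonoidAlgebra.induction_on with
      | of h => exact hW h w hw
      | add a b ha hb => rw [add_smul]; exact W.add_mem ha hb
      | smul c a ha => rw [smul_assoc]; exact ZMod.smul_mem ha c }

end FrattiniQuotient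

/-! ### Frattini subgroups and complements in the semidirect product -/

section FrattiniSemidirect

variable {p : ℕ} [Fact p.Prime] {H P V : Type*} [Group H] [Group P]
  [AddCommGroup V] [Module (ZMod p) V] [Module (MonoidAlgebra (ZMod p) H) V] {φ : H →* MulAut P}
  {q : P →* Multiplicative V}

theorem IsFrattiniQuotient.map_eq_one_iff (hq : IsFrattiniQuotient p φ q) (x : P) :
    q x = 1 ↔ x ∈ frattini P := by
  rw [← hq.ker_eq, MonoidHom.mem_ker]

theorem IsFrattiniQuotient.exists_toAdd_eq (hq : IsFrattiniQuotient p φ q) (v : V) :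
    ∃ x, (q x).toAdd = v :=
  hq.surjective (Multiplicative.ofAdd v)

theorem map_inl_frattini_le [Finite H] [Finite P] :
    (frattini P).map (SemidirectProduct.inl : P →* P ⋊[φ] H) ≤ frattini (P ⋊[φ] H) := by
  have : Finite (P ⋊[φ] H) := Finite.of_equiv _ SemidirectProduct.equivProd.symm
  let N := (frattini P).map (SemidirectProduct.inl : P →* P ⋊[φ] H)
  have hchar : ∀ h, ∀ x ∈ frattini P, φ h x ∈ frattini P := fun h x hx => by
    rw [← Subgroup.characteristic_iff_comap_eq.mp
      (inferInstance : (frattini P).Characteristic) (φ h)] at hx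
    exact hx
  have hN : N.Normal := by
    refine ⟨?_⟩
    rintro _ ⟨x, hx, rfl⟩ g
    refine ⟨g.left * φ g.right x * g.left⁻¹,
      (inferInstance : (frattini P).Normal).conj_mem _ (hchar _ x hx) _, ?_⟩
    have hg := SemidirectProduct.inl_left_mul_inr_right g
    calc SemidirectProduct.inl (g.left * φ g.right x * g.left⁻¹)
        = (SemidirectProduct.inl g.left * SemidirectProduct.inr g.right) *
          SemidirectProduct.inl x *
          (SemidirectProduct.inl g.left * SemidirectProduct.inr g.right)⁻¹ := by
          rw [map_mul, map_mul, SemidirectProduct.inl_aut, map_inv SemidirectProduct.inl,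
            map_inv SemidirectProduct.inr, mul_inv_rev]
          simp only [mul_assoc]
      _ = g * SemidirectProduct.inl x * g⁻¹ := by rw [hg]
  change N ≤ _
  simp only [frattini, Order.radical, le_iInf_iff]
  intro M hM
  by_contra hNM
  have hsup : M ⊔ N = ⊤ := hM.2 _ (left_lt_sup.mpr hNM)
  -- Dedekind's law: $G=MN$ with $N\le P$ gives $P=(M\cap P)\Phi(P)$, hence $P\le M$.
  have htop : M.comap SemidirectProduct.inl ⊔ frattini P = ⊤ := by
    rw [Subgroup.eq_top_iff']
    intro x
    have hx : (SemidirectProduct.inl x : P ⋊[φ] H) ∈ M ⊔ N := hsup ▸ Subgroup.mem_top _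
    rw [← SetLike.mem_coe, Subgroup.mul_normal] at hx
    obtain ⟨m, hm, _, ⟨y, hy, rfl⟩, hmy⟩ := hx
    have hmx : m = SemidirectProduct.inl (x * y⁻¹) := by
      rw [map_mul, map_inv, ← hmy, mul_inv_cancel_right]
    have := Subgroup.mul_mem_sup (show x * y⁻¹ ∈ M.comap SemidirectProduct.inl by
        rw [Subgroup.mem_comap, ← hmx]; exact hm) hy
    simpa using this
  have := frattini_nongenerating htop
  refine hNM ?_
  rintro _ ⟨x, -, rfl⟩
  exact (this ▸ Subgroup.mem_top x : x ∈ M.comap SemidirectProduct.inl)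

/-- A `p'`-group acting faithfully on a finite `p`-group acts faithfully on its Frattini
quotient. -/
theorem IsFrattiniQuotient.eq_one_of_forall_smul_eq [Finite P] (hP : IsPGroup p P)
    (hH : ¬ p ∣ Nat.card H) [Finite H] (hφ : Function.Injective φ)
    (hq : IsFrattiniQuotient p φ q) {h : H}
    (hh : ∀ v : V, MonoidAlgebra.of (ZMod p) H h • v = v) : h = 1 := by
  classical
  by_contra hne
  have ho : orderOf h ≠ 1 := fun h1 => hne (orderOf_eq_one_iff.mp h1)
  set r := (orderOf h).minFac with hr
  have : Fact r.Prime := ⟨Nat.minFac_prime ho⟩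
  set g := h ^ (orderOf h / r) with hg
  have hgr : orderOf g = r := orderOf_pow_orderOf_div (orderOf_pos h).ne' (Nat.minFac_dvd _)
  have hrp : r ≠ p := by
    rintro rfl
    exact hH ((Nat.minFac_dvd _).trans (orderOf_dvd_natCard h))
  have hpow : ∀ (m : ℕ) (v : V), MonoidAlgebra.of (ZMod p) H (h ^ m) • v = v := by
    intro m v
    induction m with
    | zero => rw [pow_zero, map_one, one_smul]
    | succ m ih => rw [pow_succ, map_mul, mul_smul, hh, ih]
  have hgq : ∀ x, q (φ g x) = q x := fun x =>
    Multiplicative.toAdd.injective (by rw [hq.map_smul, hpow])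
  -- `g` has prime order `r ≠ p` and permutes each fibre of `q`, whose size is a power of `p`; so it
  -- fixes a point there. The fixed points and $\Phi(P)$ then generate `P`.
  have hfix : ∀ x, ∃ y, φ g y = y ∧ q y = q x := by
    intro x
    let α := {y // q y = q x}
    have : Fintype α := Fintype.ofFinite α
    let f : Function.End α := fun y => ⟨φ g y, (hgq y).trans y.2⟩
    have hf : ∀ (m : ℕ) (y : α), ((f ^ m) y : P) = φ (g ^ m) y := by
      intro m
      induction m with
      | zero => intro y; simp; rfl
      | succ m ih =>
        intro y
        rw [pow_succ, pow_succ, map_mul]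
        exact ih (f y)
    have hf1 : f ^ r ^ 1 = 1 := by
      funext y
      apply Subtype.ext
      rw [hf, pow_one, ← hgr, pow_orderOf_eq_one, map_one]
      rfl
    have hmod := Equiv.Perm.card_fixedPoints_modEq hf1
    have hcard : Fintype.card α = Nat.card q.ker := by
      rw [← Nat.card_eq_fintype_card]
      exact Nat.card_congr (MonoidHom.fiberEquivKer q x)
    by_contra! hno
    have h0 : Fintype.card f.fixedPoints = 0 := by
      rw [Fintype.card_eq_zero_iff]
      exact ⟨fun ⟨y, hy⟩ => hno y (congrArg Subtype.val hy) y.2⟩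
    rw [h0, hcard] at hmod
    obtain ⟨m, hm⟩ := IsPGroup.iff_card.mp (hP.to_subgroup q.ker)
    rw [hm] at hmod
    exact hrp ((Nat.prime_dvd_prime_iff_eq Fact.out Fact.out).mp
      ((Fact.out : r.Prime).dvd_of_dvd_pow ((Nat.modEq_zero_iff_dvd).mp hmod)))
  let F : Subgroup P :=
    { carrier := {x | φ g x = x}
      mul_mem' := fun {a b} ha hb => by
        change φ g (a * b) = a * b
        rw [map_mul, show φ g a = a from ha, show φ g b = b from hb]
      one_mem' := map_one _
      inv_mem' := fun {a} ha => by
        change φ g a⁻¹ = a⁻¹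
        rw [map_inv, show φ g a = a from ha] }
  have hF : F ⊔ frattini P = ⊤ := by
    rw [Subgroup.eq_top_iff']
    intro x
    obtain ⟨y, hy, hyx⟩ := hfix x
    rw [← mul_inv_cancel_left y x]
    refine Subgroup.mul_mem_sup hy ?_
    rw [← hq.map_eq_one_iff, map_mul, map_inv, hyx, inv_mul_cancel]
  have hFtop := frattini_nongenerating hF
  have hg1 : g = 1 := hφ (by
    rw [map_one]
    ext x
    exact (hFtop ▸ Subgroup.mem_top x : x ∈ F))
  rw [hg1, orderOf_one] at hgr
  exact (Fact.out : r.Prime).one_lt.ne hgr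

/-- Otherwise some subgroup of order `p ^ d` lies in $\Phi(P)\le\Phi(G)$; being made of
non-generators, it has only `⊤` as a possible complement. -/
theorem IsCGroup.lt_of_card_frattini [Finite P] [Finite H] {s d : ℕ}
    (hs : Nat.card (frattini P) = p ^ s) (hd : 0 < d) (hG : IsCGroup p d (P ⋊[φ] H)) : s < d := by
  have : Finite (P ⋊[φ] H) := Finite.of_equiv _ SemidirectProduct.equivProd.symm
  by_contra! hle
  obtain ⟨X, hX⟩ := Sylow.exists_subgroup_card_pow_prime (G := frattini P) p
    (hs ▸ pow_dvd_pow p hle)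
  let f : frattini P →* P ⋊[φ] H := SemidirectProduct.inl.comp (frattini P).subtype
  have hf : Function.Injective f :=
    SemidirectProduct.inl_injective.comp (frattini P).subtype_injective
  have hcard : Nat.card (X.map f) = p ^ d := by
    rw [← hX]
    exact (Nat.card_congr (X.equivMapOfInjective f hf).toEquiv).symm
  obtain ⟨K, hK⟩ := hG _ hcard
  have hle : X.map f ≤ frattini (P ⋊[φ] H) := by
    rintro _ ⟨x, -, rfl⟩
    exact map_inl_frattini_le ⟨x, x.2, rfl⟩
  have hKtop : K = ⊤ := frattini_nongenerating <| top_le_iff.mp <|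
    (sup_comm (X.map f) K ▸ hK.sup_eq_top).symm.le.trans (sup_le_sup_left hle K)
  rw [hKtop, Subgroup.isComplement'_top_right] at hK
  rw [hK, Subgroup.card_bot] at hcard
  exact (Nat.one_lt_pow hd.ne' (Fact.out : p.Prime).one_lt).ne hcard

variable [IsScalarTower (ZMod p) (MonoidAlgebra (ZMod p) H) V]

theorem IsFrattiniQuotient.comap_inl_frattini [Finite H] [Finite P]
    [IsSemisimpleModule (MonoidAlgebra (ZMod p) H) V] (hq : IsFrattiniQuotient p φ q) :
    (frattini (P ⋊[φ] H)).comap SemidirectProduct.inl = frattini P := by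
  have : Finite (P ⋊[φ] H) := Finite.of_equiv _ SemidirectProduct.equivProd.symm
  refine le_antisymm ?_ (Subgroup.map_le_iff_le_comap.mp map_inl_frattini_le)
  let N : Submodule (MonoidAlgebra (ZMod p) H) V := AddSubgroup.toMonoidAlgebraSubmodule
    (Subgroup.toAddSubgroup' ((((frattini (P ⋊[φ] H)).comap SemidirectProduct.inl).map q))) (by
      rintro h w ⟨x, hx, hxw⟩
      refine ⟨φ h x, ?_, ?_⟩
      · change SemidirectProduct.inl (φ h x) ∈ frattini (P ⋊[φ] H)
        rw [SemidirectProduct.inl_aut, map_inv]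
        exact (inferInstance : (frattini (P ⋊[φ] H)).Normal).conj_mem _ hx _
      · apply Multiplicative.toAdd.injective
        rw [hq.map_smul, hxw]
        rfl)
  have hNmem : ∀ x, SemidirectProduct.inl x ∈ frattini (P ⋊[φ] H) → (q x).toAdd ∈ N :=
    fun x hx => ⟨x, hx, rfl⟩
  have hNmem' : ∀ v ∈ N, ∃ x, SemidirectProduct.inl x ∈ frattini (P ⋊[φ] H) ∧ (q x).toAdd = v :=
    fun v ⟨x, hx, hxv⟩ => ⟨x, hx, hxv⟩
  obtain ⟨W, hW⟩ := exists_isCompl N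
  -- `K` is the preimage of `W` in `P`, extended by `H`. It supplements $\Phi(G)$, hence is
  -- everything, so `W = ⊤` and `N = ⊥`.
  let K : Subgroup (P ⋊[φ] H) :=
    { carrier := {g | (q g.left).toAdd ∈ W}
      mul_mem' := fun {a b} ha hb => by
        change (q (a.left * φ a.right b.left)).toAdd ∈ W
        rw [map_mul, toAdd_mul, hq.map_smul]
        exact W.add_mem ha (W.smul_mem _ hb)
      one_mem' := by simp
      inv_mem' := fun {a} ha => by
        change (q (φ a.right⁻¹ a.left⁻¹)).toAdd ∈ W
        rw [hq.map_smul, map_inv q, toAdd_inv]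
        exact W.smul_mem _ (W.neg_mem ha) }
  have hK : K ⊔ frattini (P ⋊[φ] H) = ⊤ := by
    rw [Subgroup.eq_top_iff']
    intro g
    obtain ⟨v, hv, w, hw, hvw⟩ := Submodule.mem_sup.mp
      (hW.sup_eq_top ▸ Submodule.mem_top (x := (q g.left).toAdd))
    obtain ⟨y, hy, rfl⟩ := hNmem' v hv
    rw [← SemidirectProduct.inl_left_mul_inr_right g]
    refine mul_mem ?_ (Subgroup.mem_sup_left ?_)
    · rw [← inv_mul_cancel_right g.left y, map_mul]
      refine Subgroup.mul_mem_sup ?_ hy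
      change (q (g.left * y⁻¹)).toAdd ∈ W
      rw [map_mul, toAdd_mul, ← hvw, map_inv, toAdd_inv]
      simpa [add_comm] using hw
    · change (q 1).toAdd ∈ W
      simp
  have hKtop := frattini_nongenerating hK
  intro x hx
  rw [← hq.map_eq_one_iff]
  have hxW : (q x).toAdd ∈ W :=
    (hKtop ▸ Subgroup.mem_top _ : (SemidirectProduct.inl x : P ⋊[φ] H) ∈ K)
  exact Multiplicative.toAdd.injective (Submodule.disjoint_def.mp hW.disjoint _ (hNmem x hx) hxW)

theorem IsFrattiniQuotient.hasSubmoduleComplements [Finite P] [Finite H]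
    (hq : IsFrattiniQuotient p φ q) {s d : ℕ} (hs : Nat.card (frattini P) = p ^ s) (hsd : s ≤ d)
    (hG : IsCGroup p d (P ⋊[φ] H)) :
    HasSubmoduleComplements (ZMod p) (MonoidAlgebra (ZMod p) H) V (d - s) := by
  intro X hX
  have hfin : Finite V := Finite.of_surjective (fun x => (q x).toAdd) hq.exists_toAdd_eq
  let Y : Subgroup P := (AddSubgroup.toSubgroup X.toAddSubgroup).comap q
  have hYcard : Nat.card Y = p ^ d := by
    have h1 := Y.card_mul_index
    rw [Subgroup.index_comap_of_surjective _ hq.surjective] at h1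
    have h2 := (AddSubgroup.toSubgroup X.toAddSubgroup).card_mul_index
    have h3 := q.ker.card_mul_index
    rw [Subgroup.index_ker, MonoidHom.range_eq_top.mpr hq.surjective, Subgroup.card_top,
      hq.ker_eq, hs, ← h2, ← h1] at h3
    have h4 : Nat.card (AddSubgroup.toSubgroup X.toAddSubgroup) = p ^ (d - s) := by
      rw [← hX]
      have := Module.natCard_eq_pow_finrank (K := ZMod p) (V := X)
      rwa [Nat.card_zmod] at this
    rw [h4, ← mul_assoc, ← pow_add, Nat.add_sub_cancel' hsd] at h3
    exact (Nat.eq_of_mul_eq_mul_right (Nat.pos_of_ne_zero Subgroup.index_ne_zero_of_finite)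
      h3).symm
  obtain ⟨K, hK⟩ := hG (Y.map SemidirectProduct.inl) (by
    rw [← hYcard]
    exact (Nat.card_congr
      (Y.equivMapOfInjective _ SemidirectProduct.inl_injective).toEquiv).symm)
  have hmul : ∀ g : P ⋊[φ] H, ∃ y ∈ Y, (SemidirectProduct.inl y)⁻¹ * g ∈ K := by
    intro g
    obtain ⟨⟨⟨_, y, hy, rfl⟩, ⟨k, hk⟩⟩, rfl⟩ := hK.2 g
    exact ⟨y, hy, by simpa using hk⟩
  -- `K` need not contain `H`, but each `h` lies in `K` up to a factor from `Y`, and conjugation by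
  -- elements of `P` is trivial on `V`. So the image of `K ∩ P` is `H`-invariant.
  let U : Submodule (MonoidAlgebra (ZMod p) H) V := AddSubgroup.toMonoidAlgebraSubmodule
    (Subgroup.toAddSubgroup' ((K.comap SemidirectProduct.inl).map q)) (by
      rintro h w ⟨x, hx, hxw⟩
      obtain ⟨y, -, hy⟩ := hmul (SemidirectProduct.inr h)
      refine ⟨y⁻¹ * φ h x * y, ?_, ?_⟩
      · change SemidirectProduct.inl (y⁻¹ * φ h x * y) ∈ K
        have := mul_mem (mul_mem hy hx) (inv_mem hy)
        rw [map_mul, map_mul, SemidirectProduct.inl_aut]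
        simpa [mul_assoc] using this
      · apply Multiplicative.toAdd.injective
        have : q (y⁻¹ * φ h x * y) = q (φ h x) := by
          rw [map_mul q, map_mul q, mul_right_comm, ← map_mul q, inv_mul_cancel, map_one, one_mul]
        rw [this, hq.map_smul, hxw]
        rfl)
  have hUmem : ∀ x, SemidirectProduct.inl x ∈ K → (q x).toAdd ∈ U := fun x hx => ⟨x, hx, rfl⟩
  have hUmem' : ∀ v ∈ U, ∃ x, SemidirectProduct.inl x ∈ K ∧ (q x).toAdd = v :=
    fun v ⟨x, hx, hxv⟩ => ⟨x, hx, hxv⟩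
  refine ⟨U, ?_, ?_⟩
  · rw [Submodule.disjoint_def]
    intro v hvX hvU
    obtain ⟨x, hx, rfl⟩ := hUmem' v hvU
    have h1 : (SemidirectProduct.inl x : P ⋊[φ] H) = 1 :=
      Subgroup.disjoint_def.mp hK.disjoint ⟨x, hvX, rfl⟩ hx
    have h2 : x = 1 := SemidirectProduct.inl_injective (h1.trans (map_one _).symm)
    rw [h2, map_one, toAdd_one]
  · rw [codisjoint_iff, Submodule.eq_top_iff']
    intro v
    obtain ⟨z, rfl⟩ := hq.exists_toAdd_eq v
    obtain ⟨y, hy, hk⟩ := hmul (SemidirectProduct.inl z)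
    rw [← mul_inv_cancel_left y z, map_mul, toAdd_mul]
    refine Submodule.add_mem_sup hy (hUmem _ ?_)
    rwa [map_mul, map_inv]

end FrattiniSemidirect

/-! ### One-dimensional constituents and supersolvability -/

section OneDimensional

variable {p : ℕ} [Fact p.Prime] {H P V : Type*} [Group H] [Group P]
  [AddCommGroup V] [Module (ZMod p) V] [Module (MonoidAlgebra (ZMod p) H) V] {φ : H →* MulAut P}
  {q : P →* Multiplicative V}

theorem exists_of_smul_eq_smul_of_finrank_eq_one {S : Submodule (MonoidAlgebra (ZMod p) H) V}
    (hS : Module.finrank (ZMod p) S = 1) {v : V} (hv : v ∈ S) (h : H) :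
    ∃ c : ZMod p, MonoidAlgebra.of (ZMod p) H h • v = c • v := by
  by_cases h0 : v = 0
  · exact ⟨0, by simp [h0]⟩
  obtain ⟨c, hc⟩ := exists_smul_eq_of_finrank_eq_one hS (x := ⟨v, hv⟩)
    (fun h => h0 (congrArg Subtype.val h)) ⟨_, S.smul_mem (MonoidAlgebra.of (ZMod p) H h) hv⟩
  exact ⟨c, (congrArg Subtype.val hc).symm⟩

variable [IsScalarTower (ZMod p) (MonoidAlgebra (ZMod p) H) V]

/-- Every element of `H` acts by a scalar on each simple submodule, and these span `V`; so
commutators act trivially. -/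
theorem mul_comm_of_finrank_eq_one [IsSemisimpleModule (MonoidAlgebra (ZMod p) H) V]
    (hS : ∀ S : Submodule (MonoidAlgebra (ZMod p) H) V,
      IsSimpleModule (MonoidAlgebra (ZMod p) H) S → Module.finrank (ZMod p) S = 1)
    (hfaith : ∀ h : H, (∀ v : V, MonoidAlgebra.of (ZMod p) H h • v = v) → h = 1) (g h : H) :
    g * h = h * g := by
  rw [← commutatorElement_eq_one_iff_mul_comm]
  refine hfaith _ fun v => ?_
  have hcomm : ∀ v : V, MonoidAlgebra.of (ZMod p) H (g * h) • v =
      MonoidAlgebra.of (ZMod p) H (h * g) • v := by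
    intro v
    have hv : v ∈ ⨆ S : {S : Submodule (MonoidAlgebra (ZMod p) H) V | IsAtom S},
        (S : Submodule (MonoidAlgebra (ZMod p) H) V) := by
      rw [← sSup_eq_iSup', sSup_atoms_eq_top]
      trivial
    refine Submodule.iSup_induction _ (motive := fun v => MonoidAlgebra.of (ZMod p) H (g * h) • v =
      MonoidAlgebra.of (ZMod p) H (h * g) • v) hv ?_ (by simp) ?_
    · rintro ⟨S, hSa⟩ w hw
      have hS1 := hS S (isSimpleModule_iff_isAtom.mpr hSa)
      obtain ⟨c, hc⟩ := exists_of_smul_eq_smul_of_finrank_eq_one hS1 hw g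
      obtain ⟨c', hc'⟩ := exists_of_smul_eq_smul_of_finrank_eq_one hS1 hw h
      rw [map_mul, map_mul, mul_smul, mul_smul, hc, hc', smul_comm _ c', smul_comm _ c, hc, hc',
        smul_comm]
    · intro x y hx hy
      rw [smul_add, smul_add, hx, hy]
  rw [commutatorElement_def, mul_assoc (g * h), map_mul, mul_smul, hcomm, ← mul_smul, ← map_mul]
  rw [← mul_inv_rev,
    mul_inv_cancel, map_one, one_smul]

theorem IsFrattiniQuotient.isSupersolvableGroup [Finite H] [Finite P] (hP : IsPGroup p P)
    (hH : ¬ p ∣ Nat.card H) (hφ : Function.Injective φ) (hq : IsFrattiniQuotient p φ q)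
    [IsSemisimpleModule (MonoidAlgebra (ZMod p) H) V]
    (hS : ∀ S : Submodule (MonoidAlgebra (ZMod p) H) V,
      IsSimpleModule (MonoidAlgebra (ZMod p) H) S → Module.finrank (ZMod p) S = 1) :
    IsSupersolvableGroup ((P ⋊[φ] H) ⧸ frattini (P ⋊[φ] H)) := by
  have : Finite (P ⋊[φ] H) := Finite.of_equiv _ SemidirectProduct.equivProd.symm
  have hcomm := mul_comm_of_finrank_eq_one hS
    fun h hh => hq.eq_one_of_forall_smul_eq hP hH hφ hh
  set π := QuotientGroup.mk' (frattini (P ⋊[φ] H))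
  let j : P →* (P ⋊[φ] H) ⧸ frattini (P ⋊[φ] H) := π.comp SemidirectProduct.inl
  have hj : ∀ x y, q x = q y → j x = j y := by
    intro x y hxy
    rw [← mul_inv_eq_one, ← map_inv, ← map_mul, hq.map_eq_one_iff, ← hq.comap_inl_frattini] at hxy
    rw [← mul_inv_eq_one, ← map_inv, ← map_mul]
    exact (QuotientGroup.eq_one_iff _).mpr hxy
  have hjφ : ∀ h x, j (φ h x) = π (SemidirectProduct.inr h) * j x *
      (π (SemidirectProduct.inr h))⁻¹ := fun h x => by
    simp only [j, MonoidHom.comp_apply, SemidirectProduct.inl_aut, map_mul, map_inv]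
  refine isSupersolvableGroup_of_exists_normal fun A hA hAtop => ?_
  -- Once `A` contains the image of `P`, the quotient by `A` is an image of the abelian group `H`,
  -- so any `g` outside `A` will do. Before that, `g` is taken in the image of `P`, over a vector of
  -- a one-dimensional submodule not inside the image of `A`.
  by_cases hjA : ∀ x, j x ∈ A
  · obtain ⟨g, hg⟩ : ∃ g, g ∉ A := by
      by_contra! hall
      exact hAtop ((Subgroup.eq_top_iff' A).mpr hall)
    refine ⟨g, hg, ⟨fun n hn c => ?_⟩⟩
    obtain ⟨a, rfl⟩ := QuotientGroup.mk'_surjective _ c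
    obtain ⟨b, rfl⟩ := QuotientGroup.mk'_surjective _ n
    have hab : π ⁅a, b⁆ ∈ A := by
      have : (⁅a, b⁆).right = 1 := by
        rw [← SemidirectProduct.rightHom_eq_right, map_commutatorElement,
          commutatorElement_eq_one_iff_mul_comm]
        exact hcomm _ _
      rw [← SemidirectProduct.inl_left_mul_inr_right ⁅a, b⁆, this, map_one, mul_one]
      exact hjA _
    have h1 : π a * π b * (π a)⁻¹ = π ⁅a, b⁆ * π b := by
      rw [map_commutatorElement, commutatorElement_def, inv_mul_cancel_right]
    rw [h1]
    exact mul_mem (Subgroup.mem_sup_left hab) hn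
  · push Not at hjA
    obtain ⟨x₀, hx₀⟩ := hjA
    let W : Submodule (MonoidAlgebra (ZMod p) H) V := AddSubgroup.toMonoidAlgebraSubmodule
      (Subgroup.toAddSubgroup' ((A.comap j).map q)) (by
        rintro h w ⟨x, hx, hxw⟩
        refine ⟨φ h x, ?_, ?_⟩
        · change j (φ h x) ∈ A
          rw [hjφ]
          exact hA.conj_mem _ hx _
        · apply Multiplicative.toAdd.injective
          rw [hq.map_smul, hxw]
          rfl)
    have hWmem : ∀ x, (q x).toAdd ∈ W → j x ∈ A := fun x ⟨y, hy, hyx⟩ => by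
      rw [← hj y x hyx]
      exact hy
    obtain ⟨S, hSs, hSW⟩ : ∃ S : Submodule (MonoidAlgebra (ZMod p) H) V,
        IsSimpleModule (MonoidAlgebra (ZMod p) H) S ∧ ¬ S ≤ W := by
      by_contra! hall
      have htop : (⊤ : Submodule (MonoidAlgebra (ZMod p) H) V) ≤ W := by
        rw [← sSup_atoms_eq_top]
        exact sSup_le fun S hS => hall S (isSimpleModule_iff_isAtom.mpr hS)
      exact hx₀ (hWmem x₀ (htop trivial))
    obtain ⟨v, hvS, hvW⟩ := SetLike.not_le_iff_exists.mp hSW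
    obtain ⟨x, rfl⟩ := hq.exists_toAdd_eq v
    have hzn : (Subgroup.zpowers (j x)).Normal := by
      have hconj : ∀ c, c * j x * c⁻¹ ∈ Subgroup.zpowers (j x) := by
        intro c
        obtain ⟨a, rfl⟩ := QuotientGroup.mk'_surjective _ c
        obtain ⟨c, hc⟩ := exists_of_smul_eq_smul_of_finrank_eq_one (hS S hSs) hvS a.right
        refine ⟨c.val, ?_⟩
        have h1 : π a * j x * (π a)⁻¹ = j (a.left * φ a.right x * a.left⁻¹) := by
          rw [map_mul, map_mul, hjφ, map_inv]
          conv_lhs => rw [← SemidirectProduct.inl_left_mul_inr_right a, map_mul, mul_inv_rev]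
          simp only [j, MonoidHom.comp_apply, mul_assoc]
        have h2 : q (a.left * φ a.right x * a.left⁻¹) = q (x ^ c.val) := by
          rw [map_mul, map_mul, mul_right_comm, ← map_mul, mul_inv_cancel, map_one, one_mul]
          apply Multiplicative.toAdd.injective
          rw [hq.map_smul, hc, map_pow, toAdd_pow, ← Nat.cast_smul_eq_nsmul (ZMod p),
            ZMod.natCast_zmod_val]
        rw [h1, hj _ _ h2, map_pow]
        exact zpow_natCast _ _
      refine ⟨?_⟩
      rintro _ ⟨i, rfl⟩ c
      change c * j x ^ i * c⁻¹ ∈ _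
      rw [← conj_zpow]
      exact Subgroup.zpow_mem _ (hconj c) i
    refine ⟨j x, fun hx => hvW ⟨x, hx, rfl⟩, inferInstance⟩

end OneDimensional

/-! ### The main theorem -/

theorem corollaryC {H P : Type*} [Group H] [Group P] [Finite H] [Finite P]
    (p n s d : ℕ) [Fact p.Prime]
    (hH : ¬ p ∣ Nat.card H) (hP : Nat.card P = p ^ n)
    (φ : H →* MulAut P) (hφ : Function.Injective φ)
    (hsn : s ≤ n)
    (hs : Nat.card ((SemidirectProduct.inl : P →* P ⋊[φ] H).range.map
      (QuotientGroup.mk' (frattini (P ⋊[φ] H)))) = p ^ (n - s))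
    (hd : 0 < d) (hdn : d < n)
    (hG : IsNontrivialCGroup p d (P ⋊[φ] H)) :
    IsSupersolvableGroup ((P ⋊[φ] H) ⧸ frattini (P ⋊[φ] H)) ∨
    (IsCyclic H ∧ ∃ e : ℕ, 1 < e ∧
      IsHomogeneousFpModule p e
        ((QuotientGroup.mk' (frattini (P ⋊[φ] H))).comp SemidirectProduct.inr)
        ((SemidirectProduct.inl : P →* P ⋊[φ] H).range.map
          (QuotientGroup.mk' (frattini (P ⋊[φ] H)))) ∧
      e ∣ Int.gcd ((d : ℤ) - (s : ℤ)) ((n : ℤ) - (s : ℤ))) := by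
  have hPp : IsPGroup p P := IsPGroup.of_card hP
  obtain ⟨V, i₁, i₂, i₃, i₄, q, hq⟩ := exists_isFrattiniQuotient p hPp φ
  -- This is the hypothesis of Maschke's theorem, which makes `V` semisimple.
  have hne : NeZero (Nat.card H : ZMod p) := ⟨by rwa [Ne, ZMod.natCast_eq_zero_iff]⟩
  have hfin : Finite V := Finite.of_surjective (fun x => (q x).toAdd) hq.exists_toAdd_eq
  set A := (SemidirectProduct.inl : P →* P ⋊[φ] H).range.map
    (QuotientGroup.mk' (frattini (P ⋊[φ] H)))
  let j : P →* A := ((QuotientGroup.mk' (frattini (P ⋊[φ] H))).comp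
    SemidirectProduct.inl).codRestrict A fun x => ⟨_, ⟨x, rfl⟩, rfl⟩
  have hj : Function.Surjective j := by
    rintro ⟨_, _, ⟨x, rfl⟩, rfl⟩
    exact ⟨x, rfl⟩
  -- Both kernels are $P\cap\Phi(G)=\Phi(P)$, which identifies `V` with the image `A` of `P`.
  have hker : q.ker = j.ker := by
    rw [hq.ker_eq, ← hq.comap_inl_frattini, show j.ker = _ from MonoidHom.ker_codRestrict ..,
      ← MonoidHom.comap_ker, QuotientGroup.ker_mk']
  let ι : Multiplicative V ≃* A := (QuotientGroup.quotientKerEquivOfSurjective q hq.surjective).symm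
    |>.trans <| (QuotientGroup.quotientMulEquivOfEq hker).trans
      (QuotientGroup.quotientKerEquivOfSurjective j hj)
  have hι : ∀ x, ι (q x) = j x := fun x => by
    have : (QuotientGroup.quotientKerEquivOfSurjective q hq.surjective).symm (q x) = x := by
      rw [MulEquiv.symm_apply_eq]
      rfl
    simp only [ι, MulEquiv.trans_apply, this]
    rfl
  have hpp : 1 < p := (Fact.out : p.Prime).one_lt
  have hVcard : Nat.card V = p ^ (n - s) := by
    rw [← hs]
    exact Nat.card_congr (Multiplicative.ofAdd.trans ι.toEquiv)
  have hVrank : Module.finrank (ZMod p) V = n - s := by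
    have := Module.natCard_eq_pow_finrank (K := ZMod p) (V := V)
    rw [Nat.card_zmod, hVcard] at this
    exact (Nat.pow_right_injective hpp this).symm
  have hΦ : Nat.card (frattini P) = p ^ s := by
    have h := q.ker.card_mul_index
    rw [Subgroup.index_ker, MonoidHom.range_eq_top.mpr hq.surjective, Subgroup.card_top, hq.ker_eq,
      hP, show Nat.card (Multiplicative V) = p ^ (n - s) from hVcard] at h
    refine Nat.eq_of_mul_eq_mul_right (Nat.pow_pos (n := n - s) (zero_lt_one.trans hpp)) ?_
    rw [h, ← pow_add, Nat.add_sub_cancel' hsn]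
  have hsd : s < d := hG.1.lt_of_card_frattini hΦ hd
  have hcompl := hq.hasSubmoduleComplements hΦ hsd.le hG.1
  have hc : 0 < d - s := Nat.sub_pos_of_lt hsd
  have hcV : d - s < Module.finrank (ZMod p) V := by omega
  have hfaith : ∀ h : H, (∀ v : V, MonoidAlgebra.of (ZMod p) H h • v = v) → h = 1 :=
    fun h hh => hq.eq_one_of_forall_smul_eq hPp hH hφ hh
  by_cases hone : ∀ S : Submodule (MonoidAlgebra (ZMod p) H) V,
      IsSimpleModule (MonoidAlgebra (ZMod p) H) S → Module.finrank (ZMod p) S = 1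
  · exact Or.inl (hq.isSupersolvableGroup hPp hH hφ hone)
  refine Or.inr ?_
  push Not at hone
  obtain ⟨S, hS, hS1⟩ := hone
  have hSnt := IsSimpleModule.nontrivial (MonoidAlgebra (ZMod p) H) S
  have hSpos : 0 < Module.finrank (ZMod p) S := Module.finrank_pos
  have hSe : 1 < Module.finrank (ZMod p) S := by omega
  have htype : IsIsotypicOfType (MonoidAlgebra (ZMod p) H) V S :=
    .of_isotypicComponent_eq_top (hcompl.eq_top_of_one_lt hc hcV S hSe)
  obtain ⟨v, hv⟩ := exists_ne (0 : S)
  have hVfin : Module.Finite (MonoidAlgebra (ZMod p) H) V := Module.Finite.of_finite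
  obtain ⟨a, ⟨f⟩⟩ := htype.linearEquiv_fun
  refine ⟨isCyclic_of_exists_end_apply_eq (fun h hh => hfaith h fun v => f.injective ?_) hv
      (hcompl.exists_end_apply_eq hc hcV S htype hv),
    Module.finrank (ZMod p) S, hSe,
    ⟨V, i₁, i₂, i₃, i₄, ι, fun h v => ?_, inferInstance, htype.isIsotypic, fun W hW => ?_⟩, ?_⟩
  -- An element acting trivially on `S` acts trivially on $S^a\cong V$, so faithfulness passes from
  -- `V` to `S`.
  · rw [map_smul]
    exact funext fun i => hh _
  · obtain ⟨x, rfl⟩ := hq.exists_toAdd_eq v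
    rw [← hq.map_smul, ofAdd_toAdd, ofAdd_toAdd, hι, hι]
    change QuotientGroup.mk' _ (SemidirectProduct.inl (φ h x)) = _
    rw [SemidirectProduct.inl_aut, map_mul, map_mul, map_inv, map_inv]
    rfl
  · exact ((htype W).some.restrictScalars (ZMod p)).finrank_eq
  · rw [← Nat.cast_sub hsd.le, ← Nat.cast_sub hsn, Int.gcd_natCast_natCast]
    exact Nat.dvd_gcd (hcompl.finrank_dvd hcV.le S htype)
      (hVrank ▸ htype.finrank_dvd (k := ZMod p))
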